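/- **Theorem 4.1.** Let $\Omega\subset\mathbb R^3$ be a bounded Lipschitz domain with exterior unit normal $\nu$, let $\Gamma\subset\partial\Omega$ be relatively open, and let $\omega,\varepsilon_0,\mu_0>0$. Let $\varepsilon,\mu\in L^\infty(\Omega;\mathbb R_+)$ and $\sigma\in L^\infty(\Omega;\mathbb R_+\cup\{0\})$, and put $\gamma=\varepsilon+\mathrm i\sigma/\omega$. Let $(\mathbf E^t,\mathbf H^t)$ and $(\mathbf E^0,\mathbf H^0)$ be electromagnetic transmission eigenfunctions for the eigenvalue $\omega$; that is, $\mathbf E^t,\mathbf H^t,\mathbf E^0,\mathbf H^0\in H(\mathrm{curl},\Omega)$ are not all zero and satisfy $$\nabla\wedge\mathbf E^t-\mathrm i\omega\mu\mathbf H^t=\mathbf 0,\quad \nabla\wedge\mathbf H^t+\mathrm i\omega\gamma\mathbf E^t=\mathbf 0\quad\text{in }\Omega,$$ $$\nabla\wedge\mathbf E^0-\mathrm i\omega\mu_0\mathbf H^0=\mathbf 0,\quad \nabla\wedge\mathbf H^0+\mathrm i\omega\varepsilon_0\mathbf E^0=\mathbf 0\quad\text{in }\Omega$$ in the sense of distributions,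 and $$\nu\wedge\mathbf E^t=\nu\wedge\mathbf E^0,\quad \nu\wedge\mathbf H^t=\nu\wedge\mathbf H^0\quad\text{on }\Gamma$$ in the sense of traces. Suppose that $\Omega$ has a conical corner at a point $\mathbf x_0\in\Gamma$: for some unit vector $\mathbf a$, some $\theta_0\in(0,\pi/2)$ and some $r_0>0$, $$\Omega\cap B_{r_0}(\mathbf x_0)=\mathcal K_{r_0}:=\{\mathbf x\in B_{r_0}(\mathbf x_0)\setminus\{\mathbf x_0\}:\ \angle(\mathbf x-\mathbf x_0,\mathbf a)<\theta_0\}.$$ Suppose further that, for some $\alpha\in(0,1)$, the fields $(\mu-\mu_0)\mathbf H^t$ and $(\gamma-\varepsilon_0)\mathbf E^t$ belong to $C^\alpha(\overline{\mathcal K_{r_0}})^3$, i.e. agree almost everywhere in $\mathcal K_{r_0}$ with such fields. Then the values of these Hölder continuous fields at the apex are zero: $$\big((\mu-\mu_0)\mathbf H^t\big)(\mathbf x_0)=\big((\gamma-\varepsilon_0)\mathbf E^t\big)(\mathbf x_0)=\mathbf 0.$$ Furthermore, write $f(\mathbf x_0)$ for the essential limit of $f(\mathbf x)$ as $\mathbf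 x\to\mathbf x_0$ in $\mathcal K_{r_0}$. If $\mu(\mathbf x_0)$ exists and $\mu(\mathbf x_0)\neq\mu_0$, then $\mathbf H^t(\mathbf x_0)$ exists and equals $\mathbf 0$; if $\gamma(\mathbf x_0)$ exists and $\gamma(\mathbf x_0)\neq\varepsilon_0$, then $\mathbf E^t(\mathbf x_0)$ exists and equals $\mathbf 0$. -/

import Mathlib

open MeasureTheory Filter Topology
open scoped NNReal

noncomputable section

/-- Three-dimensional Euclidean space. -/
abbrev R3 : Type := EuclideanSpace ℝ (Fin 3)

/-- The space of complex vector values of a field. -/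
abbrev C3 : Type := EuclideanSpace ℂ (Fin 3)

/-- The bilinear (not sesquilinear) product `a · b = ∑ aᵢ bᵢ` on `ℂ³`. -/
def dotC (a b : C3) : ℂ := ∑ i, a i * b i

/-- The partial derivative `∂ⱼ φᵢ (x)` of a complex vector field on `ℝ³`. -/
def partialDeriv (φ : R3 → C3) (j i : Fin 3) (x : R3) : ℂ :=
  (fderiv ℝ φ x (EuclideanSpace.single j 1)) i

/-- The classical curl `∇ ∧ φ` of a (differentiable) complex vector field on `ℝ³`. -/
def curl (φ : R3 → C3) (x : R3) : C3 :=
  !₂[partialDeriv φ 1 2 x - partialDeriv φ 2 1 x,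
     partialDeriv φ 2 0 x - partialDeriv φ 0 2 x,
     partialDeriv φ 0 1 x - partialDeriv φ 1 0 x]

/-- Smooth compactly supported vector fields on all of `ℝ³`. -/
def IsTestField (φ : R3 → C3) : Prop := ContDiff ℝ ((⊤ : ℕ∞) : WithTop ℕ∞) φ ∧ HasCompactSupport φ

/-- `c` is the curl of `u` in `Ω` in the sense of distributions:
`∫_Ω c · φ = ∫_Ω u · (∇ ∧ φ)` for all test fields supported inside `Ω`. -/
def IsWeakCurl (Ω : Set R3) (u c : R3 → C3) : Prop :=
  ∀ φ : R3 → C3, IsTestField φ → tsupport φ ⊆ Ω →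
    ∫ x in Ω, dotC (c x) (φ x) = ∫ x in Ω, dotC (u x) (curl φ x)

/-- `u ∈ L²(Ω; ℂ³)` with weak curl `c ∈ L²(Ω; ℂ³)`. -/
structure HasL2Curl (Ω : Set R3) (u c : R3 → C3) : Prop where
  memLp : MemLp u 2 (volume.restrict Ω)
  memLp_curl : MemLp c 2 (volume.restrict Ω)
  isWeakCurl : IsWeakCurl Ω u c

/-- The space `H(curl, Ω)`. -/
def MemHCurl (Ω : Set R3) (u : R3 → C3) : Prop := ∃ c, HasL2Curl Ω u c

/-- The tangential trace `ν ∧ u` of a field `u ∈ H(curl, Ω)` with curl `c`, as a functional on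
test fields: `⟨ν ∧ u, φ⟩ = ∫_Ω (∇ ∧ u) · φ - u · (∇ ∧ φ)`. By the divergence theorem this is
`∫_{∂Ω} (ν ∧ u) · φ dσ`, with `ν` the exterior unit normal, when `u` is smooth up to the
boundary of a Lipschitz domain. -/
def tangentialTrace (Ω : Set R3) (u c φ : R3 → C3) : ℂ :=
  ∫ x in Ω, (dotC (c x) (φ x) - dotC (u x) (curl φ x))

/-- `ν ∧ u = ν ∧ v` on the relatively open part `Γ` of `∂Ω`, for `u, v ∈ H(curl, Ω)`: the two
tangential traces agree on all test fields whose support meets `∂Ω` only inside `Γ`. -/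
def TangentialTraceEqOn (Ω Γ : Set R3) (u v : R3 → C3) : Prop :=
  ∃ cu cv : R3 → C3, HasL2Curl Ω u cu ∧ HasL2Curl Ω v cv ∧
    ∀ φ : R3 → C3, IsTestField φ → tsupport φ ∩ frontier Ω ⊆ Γ →
      tangentialTrace Ω u cu φ = tangentialTrace Ω v cv φ

/-- Bounded Lipschitz domains in `ℝ³`: bounded, open, connected, and near each boundary point,
after a rigid motion `T`, the region above the graph of a Lipschitz function. -/
structure IsBoundedLipschitzDomain (Ω : Set R3) : Prop where
  isOpen : IsOpen Ω
  isConnected : IsConnected Ω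
  isBounded : Bornology.IsBounded Ω
  lipschitz_boundary : ∀ p ∈ frontier Ω, ∃ r : ℝ, 0 < r ∧
    ∃ (T : R3 ≃ᵃⁱ[ℝ] R3) (L : ℝ≥0) (g : EuclideanSpace ℝ (Fin 2) → ℝ), LipschitzWith L g ∧
      Ω ∩ Metric.ball p r = {x | g !₂[T x 0, T x 1] < T x 2} ∩ Metric.ball p r

/-- `Γ` is a relatively open subset of `∂Ω`. -/
def IsRelOpenBoundaryPart (Ω Γ : Set R3) : Prop :=
  ∃ U : Set R3, IsOpen U ∧ Γ = frontier Ω ∩ U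

/-- The open circular cone with apex `x₀`, axis `a` and opening angle `2 θ₀`. -/
def cone (x₀ a : R3) (θ₀ : ℝ) : Set R3 :=
  {x | x ≠ x₀ ∧ InnerProductGeometry.angle (x - x₀) a < θ₀}

/-- The cone truncated by the ball of radius `r₀` around its apex. -/
def truncatedCone (x₀ a : R3) (θ₀ r₀ : ℝ) : Set R3 :=
  cone x₀ a θ₀ ∩ Metric.ball x₀ r₀

/-- The complex coefficient `γ = ε + i σ / ω`. -/
def gammaCoeff (ω : ℝ) (ε σ : R3 → ℝ) (x : R3) : ℂ :=
  (ε x : ℂ) + Complex.I * (σ x : ℂ) / (ω : ℂ)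

/-- Admissible medium parameters: `ε, μ ∈ L^∞(Ω; ℝ₊)` and `σ ∈ L^∞(Ω; ℝ₊ ∪ {0})`. -/
structure IsMedium (Ω : Set R3) (ε μ σ : R3 → ℝ) : Prop where
  memLp_eps : MemLp ε ⊤ (volume.restrict Ω)
  memLp_mu : MemLp μ ⊤ (volume.restrict Ω)
  memLp_sigma : MemLp σ ⊤ (volume.restrict Ω)
  eps_pos : ∀ᵐ x ∂(volume.restrict Ω), 0 < ε x
  mu_pos : ∀ᵐ x ∂(volume.restrict Ω), 0 < μ x
  sigma_nonneg : ∀ᵐ x ∂(volume.restrict Ω), 0 ≤ σ x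

/-- `(E^t, H^t)` and `(E^0, H^0)` are electromagnetic transmission eigenfunctions for the
eigenvalue `ω`, with transmission conditions on the part `Γ` of `∂Ω`. -/
structure IsTransmissionEigenfunctions (Ω Γ : Set R3) (ω ε₀ μ₀ : ℝ) (ε μ σ : R3 → ℝ)
    (Et Ht E0 H0 : R3 → C3) : Prop where
  memHCurl_Et : MemHCurl Ω Et
  memHCurl_Ht : MemHCurl Ω Ht
  memHCurl_E0 : MemHCurl Ω E0
  memHCurl_H0 : MemHCurl Ω H0
  curl_Et : IsWeakCurl Ω Et (fun x => (Complex.I * (ω : ℂ) * (μ x : ℂ)) • Ht x)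
  curl_Ht : IsWeakCurl Ω Ht (fun x => (-(Complex.I * (ω : ℂ) * gammaCoeff ω ε σ x)) • Et x)
  curl_E0 : IsWeakCurl Ω E0 (fun x => (Complex.I * (ω : ℂ) * (μ₀ : ℂ)) • H0 x)
  curl_H0 : IsWeakCurl Ω H0 (fun x => (-(Complex.I * (ω : ℂ) * (ε₀ : ℂ))) • E0 x)
  trace_E : TangentialTraceEqOn Ω Γ Et E0
  trace_H : TangentialTraceEqOn Ω Γ Ht H0
  nontrivial : ¬ (Et =ᵐ[volume.restrict Ω] 0 ∧ Ht =ᵐ[volume.restrict Ω] 0 ∧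
    E0 =ᵐ[volume.restrict Ω] 0 ∧ H0 =ᵐ[volume.restrict Ω] 0)

/-- `F` is a representative in `C^α` of the closure of `K` of the field `f`, which is given
almost everywhere on `K`. -/
def IsHolderRepresentative (K : Set R3) (α : ℝ≥0) (f F : R3 → C3) : Prop :=
  (∃ C : ℝ≥0, HolderOnWith C α F (closure K)) ∧ F =ᵐ[volume.restrict K] f

/-- The value at the point `x₀` of the closure of `K` of a function given almost everywhere on
`K`: `f` has the essential limit `v` as `x → x₀` in `K`, that is, every neighbourhood of `v`
contains `f x` for almost all `x ∈ K` in some neighbourhood of `x₀`. -/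
def HasEssValueAt {V : Type*} [TopologicalSpace V] (K : Set R3) (f : R3 → V) (x₀ : R3) (v : V) :
    Prop :=
  Tendsto f (ae (volume.restrict K) ⊓ 𝓝 x₀) (𝓝 v)

end

open scoped RealInnerProductSpace in
theorem mem_cone_iff {x₀ a : R3} {θ : ℝ} (ha : ‖a‖ = 1) (hθ : 0 < θ) (hθ' : θ < Real.pi / 2)
    (x : R3) : x ∈ cone x₀ a θ ↔ Real.cos θ * ‖x - x₀‖ < ⟪a, x - x₀⟫ := by
  unfold cone
  simp only [Set.mem_ofPred_eq]
  by_cases hx : x = x₀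
  · simp [hx]
  · have hn : 0 < ‖x - x₀‖ := norm_pos_iff.2 (sub_ne_zero.2 hx)
    have h1 := InnerProductGeometry.cos_angle_mul_norm_mul_norm (x - x₀) a
    rw [ha, mul_one] at h1
    rw [real_inner_comm, ← h1, mul_lt_mul_iff_left₀ hn]
    refine ⟨fun h => Real.strictAntiOn_cos ⟨InnerProductGeometry.angle_nonneg _ _,
      InnerProductGeometry.angle_le_pi _ _⟩ ⟨hθ.le, by linarith⟩ h.2, fun h => ⟨hx, ?_⟩⟩
    by_contra! h2
    have := Real.strictAntiOn_cos.antitoneOn ⟨hθ.le, by linarith⟩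
      ⟨InnerProductGeometry.angle_nonneg (x - x₀) a, InnerProductGeometry.angle_le_pi _ _⟩ h2
    linarith

theorem isOpen_cone {x₀ a : R3} {θ : ℝ} (ha : ‖a‖ = 1) (hθ : 0 < θ) (hθ' : θ < Real.pi / 2) :
    IsOpen (cone x₀ a θ) := by
  have : cone x₀ a θ = {x | Real.cos θ * ‖x - x₀‖ < inner ℝ a (x - x₀)} :=
    Set.ext (mem_cone_iff ha hθ hθ')
  rw [this]
  exact isOpen_lt (by fun_prop) (by fun_prop)

theorem integrable_exp_neg_mul_norm {c : ℝ} (hc : 0 < c) :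
    Integrable (fun x : R3 => Real.exp (-(c * ‖x‖))) := by
  have h4 : Integrable (fun x : R3 => (1 + ‖x‖) ^ (-(4 : ℝ))) :=
    integrable_one_add_norm (by simp; norm_num)
  obtain ⟨M, hM⟩ : ∃ M : ℝ, ∀ t : ℝ, 0 ≤ t → Real.exp (-(c * t)) * (1 + t) ^ 4 ≤ M := by
    refine ⟨24 / c ^ 4 * Real.exp c, fun t ht => ?_⟩
    have h := Real.pow_div_factorial_le_exp (c * (1 + t)) (by positivity) 4
    have e4 : ((Nat.factorial 4 : ℕ) : ℝ) = 24 := by norm_num [Nat.factorial]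
    rw [e4, mul_add, mul_one, Real.exp_add, div_le_iff₀ (by norm_num)] at h
    rw [Real.exp_neg, inv_mul_le_iff₀ (Real.exp_pos _), div_mul_eq_mul_div, mul_div_assoc',
      le_div_iff₀ (by positivity)]
    calc (1 + t) ^ 4 * c ^ 4 = (c + c * t) ^ 4 := by ring
      _ ≤ _ := h
      _ = _ := by ring
  refine (h4.const_mul M).mono' (by fun_prop) (ae_of_all _ fun x => ?_)
  rw [Real.norm_of_nonneg (Real.exp_pos _).le, Real.rpow_neg (by positivity), ← div_eq_mul_inv,
    le_div_iff₀ (by positivity)]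
  exact_mod_cast hM ‖x‖ (norm_nonneg _)

theorem integral_re_inv_sq_pos {c : ℝ} (hc : 0 < c) :
    0 < ∫ φ in (-Real.pi)..Real.pi, (c ^ 2 - Real.cos φ ^ 2) / (c ^ 2 + Real.cos φ ^ 2) ^ 2 := by
  have hpos : ∀ φ, 0 < c ^ 2 + Real.cos φ ^ 2 := fun φ => by positivity
  have hder : ∀ φ : ℝ, HasDerivAt
      (fun φ => -(1 / (c ^ 2 + 1)) * (Real.sin φ * Real.cos φ / (c ^ 2 + Real.cos φ ^ 2)))
      ((c ^ 2 - Real.cos φ ^ 2) / (c ^ 2 + Real.cos φ ^ 2) ^ 2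
        - c ^ 2 / (c ^ 2 + 1) * (1 / (c ^ 2 + Real.cos φ ^ 2))) φ := by
    intro φ
    have h1 := (Real.hasDerivAt_sin φ).mul (Real.hasDerivAt_cos φ)
    have h2 := ((Real.hasDerivAt_cos φ).pow 2).const_add (c ^ 2)
    refine ((h1.div h2 (hpos φ).ne').const_mul (-(1 / (c ^ 2 + 1)))).congr_deriv ?_
    have h0 := (hpos φ).ne'
    have h3 : c ^ 2 + 1 ≠ 0 := by positivity
    have h4 := Real.sin_sq φ
    simp only [Pi.mul_apply, Pi.pow_apply]
    field_simp
    ring_nf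
    rw [h4]
    ring
  have hc1 : Continuous fun φ : ℝ => (c ^ 2 - Real.cos φ ^ 2) / (c ^ 2 + Real.cos φ ^ 2) ^ 2 :=
    Continuous.div (by fun_prop) (by fun_prop) fun φ => (pow_pos (hpos φ) 2).ne'
  have hc2 : Continuous fun φ : ℝ => c ^ 2 / (c ^ 2 + 1) * (1 / (c ^ 2 + Real.cos φ ^ 2)) :=
    continuous_const.mul (Continuous.div (by fun_prop) (by fun_prop) fun φ => (hpos φ).ne')
  have h := intervalIntegral.integral_eq_sub_of_hasDerivAt (a := -Real.pi) (b := Real.pi)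
    (fun φ _ => hder φ) ((hc1.sub hc2).intervalIntegrable _ _)
  rw [intervalIntegral.integral_sub (hc1.intervalIntegrable _ _) (hc2.intervalIntegrable _ _)] at h
  simp only [Real.sin_pi, Real.sin_neg, neg_zero, zero_mul, zero_div, mul_zero, sub_zero] at h
  rw [sub_eq_zero] at h
  rw [h]
  refine intervalIntegral.intervalIntegral_pos_of_pos (hc2.intervalIntegrable _ _) (fun φ => ?_)
    (by linarith [Real.pi_pos])
  have := hpos φ
  positivity

theorem tendsto_pow_mul_exp_neg_mul (n : ℕ) {c : ℝ} (hc : 0 < c) :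
    Tendsto (fun t : ℝ => t ^ n * Real.exp (-(c * t))) atTop (𝓝 0) := by
  simpa using tendsto_rpow_mul_exp_neg_mul_atTop_nhds_zero n c hc

theorem integral_mul_cexp_neg_mul_Ioi {z : ℂ} (hz : 0 < z.re) :
    ∫ r in Set.Ioi (0 : ℝ), (r : ℂ) * Complex.exp (-(z * r)) = 1 / z ^ 2 := by
  have hz0 : z ≠ 0 := fun h => by simp [h] at hz
  have hder : ∀ r : ℝ, HasDerivAt
      (fun r : ℝ => -((r : ℂ) / z + 1 / z ^ 2) * Complex.exp (-(z * r)))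
      ((r : ℂ) * Complex.exp (-(z * r))) r := by
    intro r
    have h0 : HasDerivAt (fun r : ℝ => (r : ℂ)) 1 r := Complex.ofRealCLM.hasDerivAt
    refine ((((h0.div_const z).add_const (1 / z ^ 2)).neg).mul
      ((h0.const_mul z).neg.cexp)).congr_deriv ?_
    simp only [Pi.neg_apply]
    field_simp
    ring
  have hn : ∀ r : ℝ, ‖Complex.exp (-(z * r))‖ = Real.exp (-(z.re * r)) := fun r => by
    simp [Complex.norm_exp]
  have h0 : ∀ n : ℕ, Tendsto (fun r : ℝ => (r : ℂ) ^ n * Complex.exp (-(z * r))) atTop (𝓝 0) := by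
    intro n
    rw [tendsto_zero_iff_norm_tendsto_zero]
    refine (tendsto_pow_mul_exp_neg_mul n hz).congr' ?_
    filter_upwards [eventually_ge_atTop 0] with r hr
    rw [norm_mul, hn, norm_pow, Complex.norm_of_nonneg hr]
  have hint : IntegrableOn (fun r : ℝ => (r : ℂ) * Complex.exp (-(z * r))) (Set.Ioi 0) := by
    have h1 : IntegrableOn (fun r : ℝ => r ^ (1 : ℝ) * Real.exp (-z.re * r ^ (1 : ℝ)))
      (Set.Ioi 0) := integrableOn_rpow_mul_exp_neg_mul_rpow (by norm_num) (by norm_num) hz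
    simp only [Real.rpow_one] at h1
    refine h1.norm.mono' (by fun_prop) (ae_of_all _ fun r => le_of_eq ?_)
    simp [Complex.norm_exp]
  have h := integral_Ioi_of_hasDerivAt_of_tendsto' (fun r _ => hder r) hint
    (m := 0) ?_
  · rw [h]
    simp
  · have h2 := ((h0 1).const_mul (-(1 / z))).add ((h0 0).const_mul (-(1 / z ^ 2)))
    simp only [mul_zero, add_zero] at h2
    refine h2.congr fun r => ?_
    ring

theorem integral_exp_plane_ne_zero {c : ℝ} (hc : 0 < c) :
    ∫ p : ℝ × ℝ, Complex.exp (-(c * √(p.1 ^ 2 + p.2 ^ 2) : ℝ) + Complex.I * (p.1 : ℝ)) ≠ 0 := by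
  have hmul : ∀ φ : ℝ, c - Complex.I * Real.cos φ ≠ 0 := fun φ h => by
    have := congrArg Complex.re h
    simp at this
    linarith
  rw [← integral_comp_polarCoord_symm, polarCoord_target, Measure.volume_eq_prod,
    ← Measure.prod_restrict]
  have hcongr : ∫ p : ℝ × ℝ, p.1 • Complex.exp
        (-(c * √((polarCoord.symm p).1 ^ 2 + (polarCoord.symm p).2 ^ 2) : ℝ) +
          Complex.I * ((polarCoord.symm p).1 : ℝ))
        ∂((volume.restrict (Set.Ioi (0 : ℝ))).prod
          (volume.restrict (Set.Ioo (-Real.pi) Real.pi))) =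
      ∫ p : ℝ × ℝ, (p.1 : ℂ) * Complex.exp (-((c - Complex.I * Real.cos p.2) * p.1))
        ∂((volume.restrict (Set.Ioi (0 : ℝ))).prod
          (volume.restrict (Set.Ioo (-Real.pi) Real.pi))) := by
    rw [Measure.prod_restrict]
    refine setIntegral_congr_fun (measurableSet_Ioi.prod measurableSet_Ioo) fun p hp => ?_
    have hr : (0 : ℝ) < p.1 := hp.1
    have h1 : √((p.1 * Real.cos p.2) ^ 2 + (p.1 * Real.sin p.2) ^ 2) = p.1 := by
      rw [show (p.1 * Real.cos p.2) ^ 2 + (p.1 * Real.sin p.2) ^ 2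
        = p.1 ^ 2 * (Real.sin p.2 ^ 2 + Real.cos p.2 ^ 2) by ring, Real.sin_sq_add_cos_sq, mul_one,
        Real.sqrt_sq hr.le]
    simp only [polarCoord_symm_apply, h1, Complex.real_smul]
    congr 2
    push_cast
    ring
  have hint : Integrable (fun p : ℝ × ℝ =>
      (p.1 : ℂ) * Complex.exp (-((c - Complex.I * Real.cos p.2) * p.1)))
      ((volume.restrict (Set.Ioi (0 : ℝ))).prod
        (volume.restrict (Set.Ioo (-Real.pi) Real.pi))) := by
    have h1 : IntegrableOn (fun r : ℝ => r ^ (1 : ℝ) * Real.exp (-c * r ^ (1 : ℝ))) (Set.Ioi 0) :=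
      integrableOn_rpow_mul_exp_neg_mul_rpow (by norm_num) (by norm_num) hc
    simp only [Real.rpow_one] at h1
    have h2 : Integrable (fun _ : ℝ => (1 : ℝ))
      (volume.restrict (Set.Ioo (-Real.pi) Real.pi)) := integrable_const 1
    have h3 := Integrable.mul_prod h1 h2
    refine h3.norm.mono' (by fun_prop) (ae_of_all _ fun p => le_of_eq ?_)
    simp [Complex.norm_exp]
  have hin : ∀ φ : ℝ, ∫ r in Set.Ioi (0 : ℝ),
      (r : ℂ) * Complex.exp (-((c - Complex.I * Real.cos φ) * r)) =
      1 / (c - Complex.I * Real.cos φ) ^ 2 := by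
    exact fun φ => integral_mul_cexp_neg_mul_Ioi (by simpa using hc)
  rw [hcongr, integral_prod_symm _ hint]
  simp only [hin]
  intro h0
  have hre := congrArg Complex.re h0
  have hcont : Continuous fun φ : ℝ => 1 / ((c : ℂ) - Complex.I * Real.cos φ) ^ 2 :=
    continuous_const.div (by fun_prop) fun φ => pow_ne_zero 2 (hmul φ)
  have hint2 : Integrable (fun φ : ℝ => 1 / ((c : ℂ) - Complex.I * Real.cos φ) ^ 2)
      (volume.restrict (Set.Ioo (-Real.pi) Real.pi)) :=
    (hcont.integrableOn_Icc (a := -Real.pi) (b := Real.pi)).mono_set Set.Ioo_subset_Icc_self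
  have hre2 := integral_re (𝕜 := ℂ) hint2
  simp only [RCLike.re_eq_complex_re] at hre2
  rw [hre, ← integral_Ioc_eq_integral_Ioo,
    ← intervalIntegral.integral_of_le (by linarith [Real.pi_pos])] at hre2
  have hpos := integral_re_inv_sq_pos hc
  refine hpos.ne' (Eq.trans (intervalIntegral.integral_congr fun φ _ => ?_) hre2)
  have hp : 0 < c ^ 2 + Real.cos φ ^ 2 := by positivity
  have hz : ((c : ℂ) - Complex.I * Real.cos φ) * (c + Complex.I * Real.cos φ)
      = ((c ^ 2 + Real.cos φ ^ 2 : ℝ) : ℂ) := by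
    push_cast
    linear_combination (-(Complex.cos φ) ^ 2) * Complex.I_sq
  have : 1 / ((c : ℂ) - Complex.I * Real.cos φ) ^ 2
      = ((1 / (c ^ 2 + Real.cos φ ^ 2) ^ 2 : ℝ) : ℂ) * (c + Complex.I * Real.cos φ) ^ 2 := by
    have h1 := hmul φ
    have h2 : ((c ^ 2 + Real.cos φ ^ 2 : ℝ) : ℂ) ≠ 0 := by exact_mod_cast hp.ne'
    rw [Complex.ofReal_div, Complex.ofReal_pow, Complex.ofReal_one, div_mul_eq_mul_div,
      div_eq_div_iff (pow_ne_zero 2 h1) (pow_ne_zero 2 h2), ← hz]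
    ring
  have hsq : (((c : ℂ) + Complex.I * Real.cos φ) ^ 2).re = c ^ 2 - Real.cos φ ^ 2 := by
    rw [pow_two]
    simp only [Complex.mul_re, Complex.add_re, Complex.add_im, Complex.ofReal_re,
      Complex.ofReal_im, Complex.mul_im, Complex.I_re, Complex.I_im]
    ring
  rw [this, Complex.re_ofReal_mul, hsq, one_div_mul_eq_div]

theorem integrable_indicator_cone_exp {a : R3} {θ : ℝ} (ha : ‖a‖ = 1) (hθ : 0 < θ)
    (hθ' : θ < Real.pi / 2) :
    Integrable ((cone 0 a θ).indicator fun y : R3 => Real.exp (-inner ℝ a y)) := by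
  have hc : 0 < Real.cos θ := Real.cos_pos_of_mem_Ioo ⟨by linarith, hθ'⟩
  refine (integrable_exp_neg_mul_norm hc).mono'
    ((Continuous.aestronglyMeasurable (by fun_prop)).indicator (isOpen_cone ha hθ hθ').measurableSet)
    (ae_of_all _ fun y => ?_)
  by_cases hy : y ∈ cone 0 a θ
  · have := (mem_cone_iff ha hθ hθ' y).1 hy
    rw [sub_zero] at this
    rw [Set.indicator_of_mem hy, Real.norm_of_nonneg (Real.exp_pos _).le]
    exact Real.exp_le_exp.2 (by linarith)
  · rw [Set.indicator_of_notMem hy, norm_zero]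
    positivity

theorem norm_cexp_neg_add_I_mul (x y : ℝ) :
    ‖Complex.exp (-(x : ℂ) + Complex.I * (y : ℂ))‖ = Real.exp (-x) := by
  simp [Complex.norm_exp]

theorem exists_orthonormalBasis_of_inner_eq_zero {a b : R3} (ha : ‖a‖ = 1) (hb : ‖b‖ = 1)
    (hab : inner ℝ a b = 0) : ∃ B : OrthonormalBasis (Fin 3) ℝ R3, B 0 = a ∧ B 1 = b := by
  obtain ⟨B, hB⟩ := Orthonormal.exists_orthonormalBasis_extension_of_card_eq (𝕜 := ℝ) (E := R3)
    (ι := Fin 3) (by simp) (v := ![a, b, 0]) (s := {0, 1}) (by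
      rw [orthonormal_iff_ite]
      rintro ⟨i, hi⟩ ⟨j, hj⟩
      rcases hi with rfl | rfl <;> rcases hj with rfl | rfl <;>
        simp [Set.domRestrict, ha, hb, hab, real_inner_comm, Subtype.ext_iff])
  exact ⟨B, hB 0 (by simp), hB 1 (by simp)⟩

theorem cone_halfspace_iff {θ : ℝ} (hθ : 0 < θ) (hθ' : θ < Real.pi / 2) (t x y : ℝ) :
    Real.cos θ * √(t ^ 2 + (x ^ 2 + y ^ 2)) < t ↔
      Real.cos θ / Real.sin θ * √(x ^ 2 + y ^ 2) < t := by
  have hc : 0 < Real.cos θ := Real.cos_pos_of_mem_Ioo ⟨by linarith, hθ'⟩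
  have hs : 0 < Real.sin θ := Real.sin_pos_of_pos_of_lt_pi hθ (by linarith)
  have h1 : 0 ≤ Real.cos θ * √(t ^ 2 + (x ^ 2 + y ^ 2)) := by positivity
  have h2 : 0 ≤ Real.cos θ * √(x ^ 2 + y ^ 2) := by positivity
  rw [div_mul_eq_mul_div, div_lt_iff₀ hs]
  rcases le_or_gt t 0 with ht | ht
  · refine ⟨fun h => by linarith, fun h => ?_⟩
    nlinarith
  · rw [← sq_lt_sq₀ h1 ht.le, ← sq_lt_sq₀ h2 (by positivity), mul_pow, mul_pow, mul_pow,
      Real.sq_sqrt (by positivity), Real.sq_sqrt (by positivity), Real.sin_sq]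
    constructor <;> intro h <;> linarith

theorem integral_cone_exp_ne_zero {a b : R3} {θ : ℝ} (ha : ‖a‖ = 1) (hb : ‖b‖ = 1)
    (hab : inner ℝ a b = 0) (hθ : 0 < θ) (hθ' : θ < Real.pi / 2) :
    ∫ y in cone 0 a θ,
      Complex.exp (-((inner ℝ a y : ℝ) : ℂ) + Complex.I * ((inner ℝ b y : ℝ) : ℂ)) ≠ 0 := by
  have hcos : 0 < Real.cos θ := Real.cos_pos_of_mem_Ioo ⟨by linarith, hθ'⟩
  have hsin : 0 < Real.sin θ := Real.sin_pos_of_pos_of_lt_pi hθ (by linarith)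
  obtain ⟨B, rfl, rfl⟩ := exists_orthonormalBasis_of_inner_eq_zero ha hb hab
  have hmeas := (isOpen_cone (x₀ := 0) ha hθ hθ').measurableSet
  let e₁ := (MeasurableEquiv.piFinSuccAbove (fun _ : Fin 3 => ℝ) 0).symm
  let e₂ : ℝ × (ℝ × ℝ) ≃ᵐ ℝ × (Fin 2 → ℝ) :=
    (MeasurableEquiv.refl ℝ).prodCongr MeasurableEquiv.finTwoArrow.symm
  let e : ℝ × (ℝ × ℝ) ≃ᵐ R3 :=
    ((e₂.trans e₁).trans (MeasurableEquiv.toLp 2 (Fin 3 → ℝ))).trans B.measurableEquiv.symm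
  have he : MeasurePreserving e volume volume :=
    B.measurePreserving_repr_symm.comp ((PiLp.volume_preserving_toLp (Fin 3)).comp
      (((volume_preserving_piFinSuccAbove (fun _ : Fin 3 => ℝ) 0).symm _).comp
        ((MeasurePreserving.id volume).prod ((volume_preserving_finTwoArrow ℝ).symm _))))
  have hB : ∀ p i, inner ℝ (B i) (e p) = (![p.1, p.2.1, p.2.2] : Fin 3 → ℝ) i := by
    intro p i
    rw [← B.repr_apply_apply]
    have : B.repr (e p) = WithLp.toLp 2 (e₁ (e₂ p)) := B.repr.apply_symm_apply _
    rw [this]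
    fin_cases i <;> rfl
  have hnorm : ∀ p, ‖e p‖ = √(p.1 ^ 2 + (p.2.1 ^ 2 + p.2.2 ^ 2)) := by
    intro p
    rw [← Real.sqrt_sq (norm_nonneg (e p)), ← B.sum_sq_inner_right, Fin.sum_univ_three]
    simp [hB, add_assoc]
  set c : ℝ := Real.cos θ / Real.sin θ with hc
  have hcpos : 0 < c := div_pos hcos hsin
  have hmem : ∀ p, e p ∈ cone 0 (B 0) θ ↔ c * √(p.2.1 ^ 2 + p.2.2 ^ 2) < p.1 := by
    intro p
    rw [mem_cone_iff ha hθ hθ', sub_zero, hnorm, hB]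
    exact cone_halfspace_iff hθ hθ' _ _ _
  rw [← integral_indicator hmeas, ← he.integral_comp e.measurableEmbedding]
  have hint : Integrable ((cone 0 (B 0) θ).indicator fun y : R3 =>
      Complex.exp (-((inner ℝ (B 0) y : ℝ) : ℂ) + Complex.I * ((inner ℝ (B 1) y : ℝ) : ℂ))) := by
    refine (integrable_indicator_cone_exp ha hθ hθ').mono'
      ((Continuous.aestronglyMeasurable (by fun_prop)).indicator hmeas) (ae_of_all _ fun y => ?_)
    rw [norm_indicator_eq_indicator_norm]
    simp only [norm_cexp_neg_add_I_mul]
    rfl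
  have hint' := (he.integrable_comp_emb e.measurableEmbedding).2 hint
  simp only [Function.comp_def] at hint'
  rw [Measure.volume_eq_prod] at hint' ⊢
  rw [integral_prod_symm _ hint']
  have hinner : ∀ q : ℝ × ℝ, ∫ t : ℝ, (cone 0 (B 0) θ).indicator (fun y : R3 =>
      Complex.exp (-((inner ℝ (B 0) y : ℝ) : ℂ) + Complex.I * ((inner ℝ (B 1) y : ℝ) : ℂ)))
        (e (t, q)) =
      Complex.exp (-(c * √(q.1 ^ 2 + q.2 ^ 2) : ℝ) + Complex.I * (q.1 : ℝ)) := by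
    intro q
    have h1 : ∀ t : ℝ, (cone 0 (B 0) θ).indicator (fun y : R3 =>
      Complex.exp (-((inner ℝ (B 0) y : ℝ) : ℂ) + Complex.I * ((inner ℝ (B 1) y : ℝ) : ℂ)))
        (e (t, q)) = (Set.Ioi (c * √(q.1 ^ 2 + q.2 ^ 2))).indicator
          (fun t : ℝ => ((Real.exp (-t) : ℝ) : ℂ) * Complex.exp (Complex.I * (q.1 : ℝ))) t := by
      intro t
      by_cases ht : c * √(q.1 ^ 2 + q.2 ^ 2) < t
      · rw [Set.indicator_of_mem ((hmem (t, q)).2 ht), Set.indicator_of_mem (Set.mem_Ioi.2 ht),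
          hB, hB, Complex.exp_add]
        simp
      · rw [Set.indicator_of_notMem (fun h => ht ((hmem (t, q)).1 h)),
          Set.indicator_of_notMem (fun h => ht (Set.mem_Ioi.1 h))]
    simp only [h1]
    rw [integral_indicator measurableSet_Ioi, integral_mul_const, integral_complex_ofReal,
      integral_exp_neg_Ioi, Complex.exp_add]
    simp
  simp only [hinner]
  exact integral_exp_plane_ne_zero hcpos

/-- The complex exponential `exp (-τ a·(x - x₀) + i s b·(x - x₀))`. -/
noncomputable def planeWave (x₀ a b : R3) (τ s : ℝ) (x : R3) : ℂ :=
  Complex.exp (-((τ * inner ℝ a (x - x₀) : ℝ) : ℂ) +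
    Complex.I * ((s * inner ℝ b (x - x₀) : ℝ) : ℂ))

theorem norm_planeWave (x₀ a b : R3) (τ s : ℝ) (x : R3) :
    ‖planeWave x₀ a b τ s x‖ = Real.exp (-(τ * inner ℝ a (x - x₀))) :=
  norm_cexp_neg_add_I_mul _ _

theorem smul_mem_cone {a : R3} {θ : ℝ} (x₀ : R3) (ha : ‖a‖ = 1) (hθ : 0 < θ)
    (hθ' : θ < Real.pi / 2) {t : ℝ} (ht : 0 < t) (y : R3) :
    x₀ + t • y ∈ cone x₀ a θ ↔ y ∈ cone 0 a θ := by
  rw [mem_cone_iff ha hθ hθ', mem_cone_iff ha hθ hθ', add_sub_cancel_left, sub_zero, norm_smul,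
    inner_smul_right, Real.norm_of_nonneg ht.le, mul_left_comm, mul_lt_mul_iff_right₀ ht]

theorem tendsto_integral_mul_planeWave {x₀ a b : R3} {θ : ℝ} (ha : ‖a‖ = 1) (hθ : 0 < θ)
    (hθ' : θ < Real.pi / 2) {g : R3 → ℂ} (hg : Measurable g) {M : ℝ} (hM : ∀ x, ‖g x‖ ≤ M)
    (hsupp : ∀ x, x ∉ cone x₀ a θ → g x = 0) {g₀ : ℂ}
    (hlim : Tendsto g (𝓝[cone x₀ a θ] x₀) (𝓝 g₀)) {s : ℝ → ℝ}
    (hs : Tendsto (fun τ => s τ / τ) atTop (𝓝 1)) :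
    Tendsto (fun τ : ℝ => (τ : ℂ) ^ 3 * ∫ x, g x * planeWave x₀ a b τ (s τ) x) atTop
      (𝓝 (g₀ * ∫ y in cone 0 a θ,
        Complex.exp (-((inner ℝ a y : ℝ) : ℂ) + Complex.I * ((inner ℝ b y : ℝ) : ℂ)))) := by
  have hmeas := (isOpen_cone (x₀ := 0) ha hθ hθ').measurableSet
  have hM0 : 0 ≤ M := (norm_nonneg _).trans (hM 0)
  have hscale : ∀ τ : ℝ, 0 < τ → ∫ y, g (x₀ + τ⁻¹ • y) *
      Complex.exp (-((inner ℝ a y : ℝ) : ℂ) + Complex.I * ((s τ / τ * inner ℝ b y : ℝ) : ℂ)) =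
      (τ : ℂ) ^ 3 * ∫ x, g x * planeWave x₀ a b τ (s τ) x := by
    intro τ hτ
    rw [← integral_add_left_eq_self (fun x => g x * planeWave x₀ a b τ (s τ) x) x₀]
    have h := Measure.integral_comp_smul (volume : Measure R3)
      (fun z => g (x₀ + z) * planeWave x₀ a b τ (s τ) (x₀ + z)) τ⁻¹
    rw [show |((τ⁻¹) ^ Module.finrank ℝ R3)⁻¹| = τ ^ 3 by
      rw [finrank_euclideanSpace, Fintype.card_fin, inv_pow, inv_inv, abs_of_pos (by positivity)],
      Complex.real_smul, Complex.ofReal_pow] at h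
    rw [← h]
    congr 1
    ext y
    simp only [planeWave, add_sub_cancel_left, inner_smul_right, mul_inv_cancel_left₀ hτ.ne',
      div_eq_mul_inv, mul_assoc]
  rw [← integral_const_mul, ← integral_indicator hmeas]
  refine Tendsto.congr' ((eventually_gt_atTop 0).mono fun τ hτ => hscale τ hτ) ?_
  refine tendsto_integral_filter_of_dominated_convergence
    (fun y => M * (cone 0 a θ).indicator (fun y => Real.exp (-inner ℝ a y)) y)
    (Eventually.of_forall fun τ => ?_) ?_ ((integrable_indicator_cone_exp ha hθ hθ').const_mul M)
    (ae_of_all _ fun y => ?_)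
  · refine Measurable.aestronglyMeasurable ((hg.comp (by fun_prop)).mul (by fun_prop))
  · filter_upwards [eventually_gt_atTop 0] with τ hτ
    refine ae_of_all _ fun y => ?_
    by_cases hy : y ∈ cone 0 a θ
    · rw [Set.indicator_of_mem hy, norm_mul, norm_cexp_neg_add_I_mul]
      exact mul_le_mul_of_nonneg_right (hM _) (Real.exp_pos _).le
    · rw [hsupp _ fun h => hy ((smul_mem_cone x₀ ha hθ hθ' (inv_pos.2 hτ) y).1 h)]
      simp [Set.indicator_of_notMem hy]
  · by_cases hy : y ∈ cone 0 a θ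
    · rw [Set.indicator_of_mem hy]
      refine Tendsto.mul (hlim.comp (tendsto_nhdsWithin_iff.2 ⟨?_, ?_⟩)) ?_
      · simpa using ((tendsto_inv_atTop_zero (𝕜 := ℝ)).smul_const y).const_add x₀
      · filter_upwards [eventually_gt_atTop 0] with τ hτ
        exact (smul_mem_cone x₀ ha hθ hθ' (inv_pos.2 hτ) y).2 hy
      · have h1 : Tendsto (fun τ => ((s τ / τ * inner ℝ b y : ℝ) : ℂ)) atTop
            (𝓝 ((inner ℝ b y : ℝ) : ℂ)) := by
          have := (hs.mul_const (inner ℝ b y))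
          rw [one_mul] at this
          exact (Complex.continuous_ofReal.tendsto _).comp this
        exact (Complex.continuous_exp.tendsto _).comp ((h1.const_mul _).const_add _)
    · rw [Set.indicator_of_notMem hy]
      refine tendsto_const_nhds.congr' ?_
      filter_upwards [eventually_gt_atTop 0] with τ hτ
      rw [hsupp _ fun h => hy ((smul_mem_cone x₀ ha hθ hθ' (inv_pos.2 hτ) y).1 h), zero_mul]

theorem tendsto_integral_mul_planeWave_of_far {x₀ a b : R3} {θ : ℝ} (ha : ‖a‖ = 1) (hθ : 0 < θ)
    (hθ' : θ < Real.pi / 2) {K : Set R3} (hK : K ⊆ cone x₀ a θ) (hKm : MeasurableSet K)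
    {h : R3 → ℂ} (hint : IntegrableOn h K) {δ : ℝ} (hδ : 0 < δ)
    (hfar : ∀ x, h x ≠ 0 → δ ≤ ‖x - x₀‖) (s : ℝ → ℝ) (n : ℕ) :
    Tendsto (fun τ : ℝ => (τ : ℂ) ^ n * ∫ x in K, planeWave x₀ a b τ (s τ) x * h x) atTop
      (𝓝 0) := by
  have hc : 0 < Real.cos θ := Real.cos_pos_of_mem_Ioo ⟨by linarith, hθ'⟩
  have hlim := (tendsto_pow_mul_exp_neg_mul n (mul_pos hc hδ)).mul_const (∫ x in K, ‖h x‖)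
  rw [zero_mul] at hlim
  refine squeeze_zero_norm' ?_ hlim
  filter_upwards [eventually_gt_atTop 0] with τ hτ
  rw [norm_mul, norm_pow, Complex.norm_of_nonneg hτ.le, mul_assoc, ← integral_const_mul]
  refine mul_le_mul_of_nonneg_left (norm_integral_le_of_norm_le (hint.norm.const_mul _) ?_)
    (by positivity)
  filter_upwards [ae_restrict_mem hKm] with x hx
  rw [norm_mul, norm_planeWave]
  by_cases h0 : h x = 0
  · simp [h0]
  · refine mul_le_mul_of_nonneg_right (Real.exp_le_exp.2 ?_) (norm_nonneg _)
    have h1 := (mem_cone_iff ha hθ hθ' x).1 (hK hx)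
    have h2 := mul_le_mul_of_nonneg_left (hfar x h0) hc.le
    nlinarith

/-- The inclusion `ℝ³ → ℂ³`. -/
def toC3 (v : R3) : C3 := WithLp.toLp 2 fun i => (v i : ℂ)

/-- The bilinear cross product on `ℂ³`. -/
def crossC (v w : C3) : C3 :=
  !₂[v 1 * w 2 - v 2 * w 1, v 2 * w 0 - v 0 * w 2, v 0 * w 1 - v 1 * w 0]

/-- The gradient of a complex function on `ℝ³`. -/
noncomputable def gradC (s : R3 → ℂ) (x : R3) : C3 :=
  WithLp.toLp 2 fun j => fderiv ℝ s x (EuclideanSpace.single j 1)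

theorem curl_smul_const {s : R3 → ℂ} {x : R3} (hs : DifferentiableAt ℝ s x) (w : C3) :
    curl (fun y => s y • w) x = crossC (gradC s x) w := by
  have h : ∀ j i, partialDeriv (fun y => s y • w) j i x = gradC s x j * w i := by
    intro j i
    simp [partialDeriv, fderiv_smul_const hs, gradC]
  simp only [curl, h, crossC]

theorem gradC_mul {s t : R3 → ℂ} {x : R3} (hs : DifferentiableAt ℝ s x)
    (ht : DifferentiableAt ℝ t x) :
    gradC (fun y => s y * t y) x = t x • gradC s x + s x • gradC t x := by
  ext j
  simp [gradC, fderiv_fun_mul hs ht]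
  ring

theorem contDiff_planeWave (x₀ a b : R3) (τ s : ℝ) {n : WithTop ℕ∞} :
    ContDiff ℝ n (planeWave x₀ a b τ s) := by
  have h : ∀ v : R3, ContDiff ℝ n fun x : R3 => inner ℝ v (x - x₀) := fun v =>
    contDiff_const.inner ℝ (contDiff_id.sub contDiff_const)
  unfold planeWave
  exact ((Complex.ofRealCLM.contDiff.comp (contDiff_const.mul (h a))).neg.add
    (contDiff_const.mul (Complex.ofRealCLM.contDiff.comp (contDiff_const.mul (h b))))).cexp

theorem gradC_planeWave (x₀ a b : R3) (τ s : ℝ) (x : R3) :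
    gradC (planeWave x₀ a b τ s) x =
      planeWave x₀ a b τ s x • (-(τ : ℂ) • toC3 a + (Complex.I * s) • toC3 b) := by
  have h0 : ∀ v : R3, HasFDerivAt (fun x : R3 => inner ℝ v (x - x₀)) (innerSL ℝ v) x := fun v =>
    ((innerSL ℝ v).hasFDerivAt.comp x ((hasFDerivAt_id x).sub_const x₀))
  have h1 : ∀ (r : ℝ) (v : R3), HasFDerivAt (fun x : R3 => ((r * inner ℝ v (x - x₀) : ℝ) : ℂ))
      (Complex.ofRealCLM.comp (r • innerSL ℝ v)) x := fun r v =>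
    Complex.ofRealCLM.hasFDerivAt.comp x ((h0 v).const_mul r)
  have h2 := ((h1 τ a).neg.add ((h1 s b).const_mul Complex.I)).cexp
  have h3 : fderiv ℝ (planeWave x₀ a b τ s) x = _ := h2.fderiv
  ext j
  simp only [gradC, h3]
  simp [toC3, planeWave, EuclideanSpace.inner_single_right]
  ring_nf

theorem dotC_smul_right (u w : C3) (c : ℂ) : dotC u (c • w) = c * dotC u w := by
  simp [dotC, Finset.mul_sum, mul_left_comm]

theorem dotC_smul_left (u w : C3) (c : ℂ) : dotC (c • u) w = c * dotC u w := by
  simp [dotC, Finset.mul_sum, mul_assoc]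

theorem dotC_sub_left (u v w : C3) : dotC (u - v) w = dotC u w - dotC v w := by
  simp [dotC, sub_mul]

/-- The plane wave with amplitude `w`, cut off by `χ`. -/
noncomputable def cutoffWave (χ : R3 → ℝ) (x₀ a b : R3) (τ s : ℝ) (w : C3) (x : R3) : C3 :=
  ((χ x : ℂ) * planeWave x₀ a b τ s x) • w

theorem dotC_cutoffWave (χ : R3 → ℝ) (x₀ a b : R3) (τ s : ℝ) (u w : C3) (x : R3) :
    dotC u (cutoffWave χ x₀ a b τ s w x) = (χ x : ℂ) * planeWave x₀ a b τ s x * dotC u w :=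
  dotC_smul_right _ _ _

theorem isTestField_cutoffWave {χ : R3 → ℝ} (hχ : ContDiff ℝ ((⊤ : ℕ∞) : WithTop ℕ∞) χ)
    (hχ' : HasCompactSupport χ) (x₀ a b : R3) (τ s : ℝ) (w : C3) :
    IsTestField (cutoffWave χ x₀ a b τ s w) := by
  refine ⟨((Complex.ofRealCLM.contDiff.comp hχ).mul (contDiff_planeWave x₀ a b τ s)).smul
    contDiff_const, hχ'.mono' ((Function.support_subset_iff'.2 fun x hx => ?_).trans subset_rfl)⟩
  have : χ x = 0 := image_eq_zero_of_notMem_tsupport hx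
  simp [cutoffWave, this]

theorem tsupport_cutoffWave_subset (χ : R3 → ℝ) (x₀ a b : R3) (τ s : ℝ) (w : C3) :
    tsupport (cutoffWave χ x₀ a b τ s w) ⊆ tsupport χ := by
  refine closure_mono fun x hx h => hx ?_
  simp [cutoffWave, h]

theorem dotC_curl_cutoffWave {χ : R3 → ℝ} (hχ : ContDiff ℝ ((⊤ : ℕ∞) : WithTop ℕ∞) χ)
    (x₀ a b : R3) (τ s : ℝ) (u w : C3) (x : R3) :
    dotC u (curl (cutoffWave χ x₀ a b τ s w) x) =
      planeWave x₀ a b τ s x * dotC u (crossC (gradC (fun y => (χ y : ℂ)) x) w) +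
      (χ x : ℂ) * planeWave x₀ a b τ s x *
        (-(τ : ℂ) * dotC u (crossC (toC3 a) w) + Complex.I * s * dotC u (crossC (toC3 b) w)) := by
  have h1 : Differentiable ℝ fun y => (χ y : ℂ) :=
    (Complex.ofRealCLM.contDiff.comp hχ).differentiable (by simp)
  have h2 : Differentiable ℝ (planeWave x₀ a b τ s) :=
    (contDiff_planeWave x₀ a b τ s (n := 1)).differentiable (by simp)
  unfold cutoffWave
  rw [curl_smul_const (s := fun y => (χ y : ℂ) * planeWave x₀ a b τ s y) ((h1.mul h2) x), gradC_mul (h1 x) (h2 x), gradC_planeWave]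
  simp [dotC, crossC, Fin.sum_univ_three]
  ring

theorem continuous_gradC {s : R3 → ℂ} (hs : ContDiff ℝ 1 s) : Continuous (gradC s) := by
  have := hs.continuous_fderiv (by simp)
  refine (PiLp.continuous_toLp 2 _).comp (continuous_pi fun j => ?_)
  fun_prop

theorem continuous_curl {φ : R3 → C3} (hφ : ContDiff ℝ 1 φ) : Continuous (curl φ) := by
  have := hφ.continuous_fderiv (by simp)
  unfold curl partialDeriv
  refine (PiLp.continuous_toLp 2 _).comp (continuous_pi fun j => ?_)
  fin_cases j <;> simp <;> fun_prop

theorem HasCompactSupport.curl {φ : R3 → C3} (hφ : HasCompactSupport φ) :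
    HasCompactSupport (curl φ) := by
  refine (hφ.fderiv (𝕜 := ℝ)).mono' ((Function.support_subset_iff'.2 fun x hx => ?_))
  have : fderiv ℝ φ x = 0 := image_eq_zero_of_notMem_tsupport hx
  ext j
  fin_cases j <;> simp [_root_.curl, partialDeriv, this]

theorem continuous_crossC_const {v : R3 → C3} (hv : Continuous v) (w : C3) :
    Continuous fun x => crossC (v x) w := by
  unfold crossC
  refine (PiLp.continuous_toLp 2 _).comp (continuous_pi fun j => ?_)
  fin_cases j <;> simp <;> fun_prop

theorem IntegrableOn.dotC {K : Set R3} {u : R3 → C3} (hu : IntegrableOn u K) {ψ : R3 → C3}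
    (hψ : Continuous ψ) (hψ' : HasCompactSupport ψ) :
    IntegrableOn (fun x => dotC (u x) (ψ x)) K := by
  obtain ⟨C, hC⟩ := hψ.bounded_above_of_compact_support hψ'
  refine integrable_finsetSum _ fun i _ => ?_
  have h1 : Integrable (fun x => u x i) (volume.restrict K) :=
    (EuclideanSpace.proj i : C3 →L[ℂ] ℂ).integrable_comp hu
  have h2 : Continuous fun x => ψ x i := by fun_prop
  exact h1.mul_bdd (c := C) h2.aestronglyMeasurable
    (ae_of_all _ fun x => (PiLp.norm_apply_le _ _).trans (hC x))

theorem toC3_frame {a b d : R3} (ha : ‖a‖ = 1) (hb : ‖b‖ = 1) (hab : inner ℝ a b = 0)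
    (hd : toC3 d = crossC (toC3 a) (toC3 b)) :
    crossC (toC3 a) (toC3 d) = -toC3 b ∧ crossC (toC3 b) (toC3 d) = toC3 a ∧
      crossC (toC3 b) (toC3 a) = -toC3 d := by
  have haa : (a 0 : ℂ) ^ 2 + (a 1 : ℂ) ^ 2 + (a 2 : ℂ) ^ 2 = 1 := by
    have := EuclideanSpace.real_norm_sq_eq a
    rw [ha, Fin.sum_univ_three] at this
    exact_mod_cast (by linarith : a 0 ^ 2 + a 1 ^ 2 + a 2 ^ 2 = (1 : ℝ))
  have hbb : (b 0 : ℂ) ^ 2 + (b 1 : ℂ) ^ 2 + (b 2 : ℂ) ^ 2 = 1 := by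
    have := EuclideanSpace.real_norm_sq_eq b
    rw [hb, Fin.sum_univ_three] at this
    exact_mod_cast (by linarith : b 0 ^ 2 + b 1 ^ 2 + b 2 ^ 2 = (1 : ℝ))
  have h : (a 0 : ℂ) * b 0 + a 1 * b 1 + a 2 * b 2 = 0 := by
    simp [PiLp.inner_apply, Fin.sum_univ_three] at hab
    exact_mod_cast (by linarith : a 0 * b 0 + a 1 * b 1 + a 2 * b 2 = (0 : ℝ))
  rw [hd]
  refine ⟨?_, ?_, ?_⟩ <;> ext j <;> fin_cases j <;> simp [crossC, toC3]
  · linear_combination (a 0 : ℂ) * h - (b 0 : ℂ) * haa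
  · linear_combination (a 1 : ℂ) * h - (b 1 : ℂ) * haa
  · linear_combination (a 2 : ℂ) * h - (b 2 : ℂ) * haa
  · linear_combination (a 0 : ℂ) * hbb - (b 0 : ℂ) * h
  · linear_combination (a 1 : ℂ) * hbb - (b 1 : ℂ) * h
  · linear_combination (a 2 : ℂ) * hbb - (b 2 : ℂ) * h
  · ring
  · ring
  · ring

theorem IsTestField.continuous {φ : R3 → C3} (h : IsTestField φ) : Continuous φ := h.1.continuous

theorem IsTestField.continuous_curl {φ : R3 → C3} (h : IsTestField φ) : Continuous (curl φ) :=
  _root_.continuous_curl (h.1.of_le (by exact_mod_cast le_top))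

theorem IsTestField.hasCompactSupport_curl {φ : R3 → C3} (h : IsTestField φ) :
    HasCompactSupport (curl φ) := h.2.curl

theorem IsWeakCurl.ae_eq {Ω : Set R3} (hΩ : IsOpen Ω) {u c c' : R3 → C3}
    (hc : IntegrableOn c Ω) (hc' : IntegrableOn c' Ω) (h : IsWeakCurl Ω u c)
    (h' : IsWeakCurl Ω u c') : c =ᵐ[volume.restrict Ω] c' := by
  have hcomp : ∀ i : Fin 3, ∀ᵐ x ∂(volume.restrict Ω), x ∈ Ω → (c x - c' x) i = 0 := by
    intro i
    refine hΩ.ae_eq_zero_of_integral_contDiff_smul_eq_zero ?_ fun g hg hgc hgs => ?_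
    · exact (Integrable.locallyIntegrable
        ((EuclideanSpace.proj i : C3 →L[ℂ] ℂ).integrable_comp (hc.sub hc'))).locallyIntegrableOn _
    · have hsub : tsupport (fun x => (g x : ℂ) • (EuclideanSpace.single i 1 : C3)) ⊆ tsupport g := by
        refine closure_mono fun x hx h0 => hx ?_
        simp [h0]
      have htest : IsTestField fun x => (g x : ℂ) • (EuclideanSpace.single i 1 : C3) :=
        ⟨(Complex.ofRealCLM.contDiff.comp hg).smul contDiff_const,
          hgc.mono' (subset_closure.trans hsub)⟩
      have h1 := (h _ htest (hsub.trans hgs)).trans (h' _ htest (hsub.trans hgs)).symm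
      rw [← sub_eq_zero, ← integral_sub (IntegrableOn.dotC hc htest.continuous htest.2)
        (IntegrableOn.dotC hc' htest.continuous htest.2)] at h1
      rw [← h1]
      congr 1
      ext x
      simp [dotC, PiLp.single_apply, mul_sub, mul_comm]
  filter_upwards [ae_all_iff.2 hcomp, ae_restrict_mem hΩ.measurableSet] with x hx hxΩ
  rw [← sub_eq_zero]
  ext i
  exact hx i hxΩ

theorem TangentialTraceEqOn.integral_eq {Ω Γ : Set R3} (hΩ : IsOpen Ω)
    [IsFiniteMeasure (volume.restrict Ω)] {u v cu cv : R3 → C3} (hcu : IntegrableOn cu Ω)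
    (hcv : IntegrableOn cv Ω) (hu : IsWeakCurl Ω u cu) (hv : IsWeakCurl Ω v cv)
    (htr : TangentialTraceEqOn Ω Γ u v) {φ : R3 → C3} (hφ : IsTestField φ)
    (hsupp : tsupport φ ∩ frontier Ω ⊆ Γ) :
    ∫ x in Ω, dotC (cu x - cv x) (φ x) = ∫ x in Ω, dotC (u x - v x) (curl φ x) := by
  obtain ⟨cu', cv', hu', hv', h⟩ := htr
  have huint : IntegrableOn u Ω := hu'.memLp.integrable (by norm_num)
  have hvint : IntegrableOn v Ω := hv'.memLp.integrable (by norm_num)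
  have hcu' : IntegrableOn cu' Ω := hu'.memLp_curl.integrable (by norm_num)
  have hcv' : IntegrableOn cv' Ω := hv'.memLp_curl.integrable (by norm_num)
  have e1 := hu'.isWeakCurl.ae_eq hΩ hcu' hcu hu
  have e2 := hv'.isWeakCurl.ae_eq hΩ hcv' hcv hv
  have h1 := h φ hφ hsupp
  unfold tangentialTrace at h1
  have hD : ∀ {w : R3 → C3}, IntegrableOn w Ω → IntegrableOn (fun x => dotC (w x) (φ x)) Ω :=
    fun hw => IntegrableOn.dotC hw hφ.continuous hφ.2
  have hC : ∀ {w : R3 → C3}, IntegrableOn w Ω →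
      IntegrableOn (fun x => dotC (w x) (curl φ x)) Ω :=
    fun hw => IntegrableOn.dotC hw hφ.continuous_curl hφ.hasCompactSupport_curl
  rw [integral_sub (hD hcu') (hC huint), integral_sub (hD hcv') (hC hvint)] at h1
  have e1' : ∫ x in Ω, dotC (cu' x) (φ x) = ∫ x in Ω, dotC (cu x) (φ x) :=
    integral_congr_ae (e1.mono fun x hx => by simp only [hx])
  have e2' : ∫ x in Ω, dotC (cv' x) (φ x) = ∫ x in Ω, dotC (cv x) (φ x) :=
    integral_congr_ae (e2.mono fun x hx => by simp only [hx])
  rw [e1', e2'] at h1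
  simp only [dotC_sub_left]
  rw [integral_sub (hD hcu) (hD hcv), integral_sub (hC huint) (hC hvint)]
  linear_combination h1

theorem mem_closure_truncatedCone {x₀ a : R3} {θ r : ℝ} (ha : ‖a‖ = 1) (hθ : 0 < θ)
    (hr : 0 < r) : x₀ ∈ closure (truncatedCone x₀ a θ r) := by
  have ha0 : a ≠ 0 := fun h => by simp [h] at ha
  have h1 : Tendsto (fun t : ℝ => x₀ + t • a) (𝓝[>] 0) (𝓝 x₀) := by
    have h : Continuous fun t : ℝ => x₀ + t • a := by fun_prop
    simpa using (h.tendsto 0).mono_left nhdsWithin_le_nhds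
  refine mem_closure_of_tendsto h1 ?_
  filter_upwards [h1 (Metric.ball_mem_nhds x₀ hr), self_mem_nhdsWithin] with t ht ht0
  refine ⟨⟨by simpa [ha0] using ne_of_gt ht0, ?_⟩, ht⟩
  rw [add_sub_cancel_left, InnerProductGeometry.angle_smul_left_of_pos _ _ ht0,
    InnerProductGeometry.angle_self ha0]
  exact hθ

theorem isOpen_truncatedCone {x₀ a : R3} {θ r : ℝ} (ha : ‖a‖ = 1) (hθ : 0 < θ)
    (hθ' : θ < Real.pi / 2) : IsOpen (truncatedCone x₀ a θ r) :=
  (isOpen_cone ha hθ hθ').inter Metric.isOpen_ball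

theorem isCompact_closure_truncatedCone (x₀ a : R3) (θ r : ℝ) :
    IsCompact (closure (truncatedCone x₀ a θ r)) :=
  (Metric.isBounded_ball.subset Set.inter_subset_right).isCompact_closure

theorem tendsto_integral_dotC_cutoffWave {x₀ a b : R3} {θ r : ℝ} (ha : ‖a‖ = 1) (hθ : 0 < θ)
    (hθ' : θ < Real.pi / 2) (hr : 0 < r) {F : R3 → C3}
    (hF : ContinuousOn F (closure (truncatedCone x₀ a θ r))) {χ : R3 → ℝ} (hχ : Continuous χ)
    (hχ₀ : χ x₀ = 1) (w : C3) {s : ℝ → ℝ} (hs : Tendsto (fun τ => s τ / τ) atTop (𝓝 1)) :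
    Tendsto (fun τ : ℝ => (τ : ℂ) ^ 3 * ∫ x in truncatedCone x₀ a θ r,
      dotC (F x) (cutoffWave χ x₀ a b τ (s τ) w x)) atTop
      (𝓝 (dotC (F x₀) w * ∫ y in cone 0 a θ,
        Complex.exp (-((inner ℝ a y : ℝ) : ℂ) + Complex.I * ((inner ℝ b y : ℝ) : ℂ)))) := by
  set K := truncatedCone x₀ a θ r
  have hKm : MeasurableSet K := (isOpen_truncatedCone ha hθ hθ').measurableSet
  let G : R3 → ℂ := fun x => (χ x : ℂ) * dotC (F x) w
  have hG : ContinuousOn G (closure K) := by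
    have h : Continuous fun z : C3 => dotC z w := by unfold dotC; fun_prop
    exact (Complex.continuous_ofReal.comp hχ).continuousOn.mul (h.comp_continuousOn hF)
  obtain ⟨M, hM⟩ := (isCompact_closure_truncatedCone x₀ a θ r).exists_bound_of_continuousOn hG
  have hx₀ := mem_closure_truncatedCone (x₀ := x₀) ha hθ hr
  have hM0 : 0 ≤ M := (norm_nonneg _).trans (hM x₀ hx₀)
  classical
  have hmeas : Measurable (K.indicator G) :=
    ContinuousOn.measurable_piecewise (hG.mono subset_closure) continuousOn_const hKm
  have h := tendsto_integral_mul_planeWave (b := b) ha hθ hθ' hmeas (M := M) (x₀ := x₀)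
    (g₀ := dotC (F x₀) w) (fun x => ?_) (fun x hx => ?_) ?_ hs
  · refine h.congr fun τ => ?_
    rw [← integral_indicator hKm]
    congr 2
    ext x
    by_cases hx : x ∈ K
    · rw [Set.indicator_of_mem hx, Set.indicator_of_mem hx, dotC_cutoffWave]
      simp only [G]
      ring
    · simp [Set.indicator_of_notMem hx]
  · by_cases hx : x ∈ K
    · rw [Set.indicator_of_mem hx]
      exact hM x (subset_closure hx)
    · simpa [Set.indicator_of_notMem hx] using hM0
  · exact Set.indicator_of_notMem (fun h => hx h.1) _
  · have h1 : Tendsto G (𝓝[K] x₀) (𝓝 (G x₀)) :=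
      (hG x₀ hx₀).mono_left (nhdsWithin_mono _ subset_closure)
    have h2 : 𝓝[cone x₀ a θ] x₀ = 𝓝[K] x₀ :=
      nhdsWithin_eq_nhdsWithin (Metric.mem_ball_self hr) Metric.isOpen_ball (by
        simp [K, truncatedCone, Set.inter_assoc])
    rw [h2]
    have h3 : G x₀ = dotC (F x₀) w := by simp [G, hχ₀]
    rw [← h3]
    refine h1.congr' ?_
    filter_upwards [self_mem_nhdsWithin] with x hx
    rw [Set.indicator_of_mem hx]

theorem tendsto_sqrt_sq_add_div {κ : ℝ} :
    Tendsto (fun τ : ℝ => √(τ ^ 2 + κ) / τ) atTop (𝓝 1) := by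
  have h : Tendsto (fun τ : ℝ => √(1 + κ * (τ⁻¹) ^ 2)) atTop (𝓝 1) := by
    have h1 := ((((tendsto_inv_atTop_zero (𝕜 := ℝ)).pow 2).const_mul κ).const_add 1).sqrt
    simpa using h1
  refine h.congr' ?_
  filter_upwards [eventually_gt_atTop 0] with τ hτ
  rw [show 1 + κ * (τ⁻¹) ^ 2 = (τ ^ 2 + κ) / τ ^ 2 by field_simp, Real.sqrt_div' _ (by positivity),
    Real.sqrt_sq hτ.le]

theorem gradC_contDiffBump_eq_zero {x₀ x : R3} (χ : ContDiffBump x₀) (hx : ‖x - x₀‖ < χ.rIn) :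
    gradC (fun y => (χ y : ℂ)) x = 0 := by
  have h : (fun y => (χ y : ℂ)) =ᶠ[𝓝 x] fun _ => 1 := by
    filter_upwards [Metric.isOpen_ball.mem_nhds (mem_ball_iff_norm.2 hx)] with y hy
    rw [χ.one_of_mem_closedBall (Metric.ball_subset_closedBall hy), Complex.ofReal_one]
  ext j
  simp [gradC, h.fderiv_eq]

theorem crossC_zero_left (w : C3) : crossC 0 w = 0 := by
  ext j
  fin_cases j <;> simp [crossC]

theorem dotC_zero_right (u : C3) : dotC u 0 = 0 := by simp [dotC]

theorem dotC_neg_right (u w : C3) : dotC u (-w) = -dotC u w := by simp [dotC]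

theorem hasCompactSupport_gradC {s : R3 → ℂ} (hs : HasCompactSupport s) :
    HasCompactSupport (gradC s) := by
  refine (hs.fderiv (𝕜 := ℝ)).mono' ((Function.support_subset_iff'.2 fun x hx => ?_))
  have : fderiv ℝ s x = 0 := image_eq_zero_of_notMem_tsupport hx
  ext j
  simp [gradC, this]

theorem toC3_neg (v : R3) : toC3 (-v) = -toC3 v := by
  ext j
  simp [toC3]

/-- The pair `(f, g)` is a weak source, tested inside a ball, of the Maxwell type system
`curl u + A v = f`, `curl v + B u = g` with vanishing Cauchy data on the boundary of `K`. -/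
structure IsWeakSource (K : Set R3) (x₀ : R3) (r : ℝ) (A B : ℂ) (u v f g : R3 → C3) : Prop where
  fst : ∀ φ, IsTestField φ → tsupport φ ⊆ Metric.ball x₀ r →
    ∫ x in K, dotC (f x) (φ x) = (∫ x in K, dotC (u x) (curl φ x)) + A * ∫ x in K, dotC (v x) (φ x)
  snd : ∀ φ, IsTestField φ → tsupport φ ⊆ Metric.ball x₀ r →
    ∫ x in K, dotC (g x) (φ x) = (∫ x in K, dotC (v x) (curl φ x)) + B * ∫ x in K, dotC (u x) (φ x)

theorem IsWeakSource.symm {K : Set R3} {x₀ : R3} {r : ℝ} {A B : ℂ} {u v f g : R3 → C3}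
    (h : IsWeakSource K x₀ r A B u v f g) : IsWeakSource K x₀ r B A v u g f := ⟨h.snd, h.fst⟩

theorem integral_dotC_curl_cutoffWave {K : Set R3} {χ : R3 → ℝ}
    (hχ : ContDiff ℝ ((⊤ : ℕ∞) : WithTop ℕ∞) χ) (hχ' : HasCompactSupport χ)
    (x₀ a b : R3) (τ s : ℝ) {u : R3 → C3} (hu : IntegrableOn u K) (w w₁ w₂ : C3)
    (h₁ : crossC (toC3 a) w = w₁) (h₂ : crossC (toC3 b) w = w₂) :
    ∫ x in K, dotC (u x) (curl (cutoffWave χ x₀ a b τ s w) x) =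
      (∫ x in K, planeWave x₀ a b τ s x *
        dotC (u x) (crossC (gradC (fun y => (χ y : ℂ)) x) w)) +
      (-(τ : ℂ) * (∫ x in K, dotC (u x) (cutoffWave χ x₀ a b τ s w₁ x)) +
        Complex.I * s * ∫ x in K, dotC (u x) (cutoffWave χ x₀ a b τ s w₂ x)) := by
  have hT : ∀ w, IntegrableOn (fun x => dotC (u x) (cutoffWave χ x₀ a b τ s w x)) K := fun w =>
    have h := isTestField_cutoffWave hχ hχ' x₀ a b τ s w
    IntegrableOn.dotC hu h.continuous h.2
  have hC : IntegrableOn (fun x => dotC (u x) (curl (cutoffWave χ x₀ a b τ s w) x)) K :=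
    have h := isTestField_cutoffWave hχ hχ' x₀ a b τ s w
    IntegrableOn.dotC hu h.continuous_curl h.hasCompactSupport_curl
  have hsum : IntegrableOn (fun x => -(τ : ℂ) * dotC (u x) (cutoffWave χ x₀ a b τ s w₁ x) +
      Complex.I * s * dotC (u x) (cutoffWave χ x₀ a b τ s w₂ x)) K :=
    ((hT w₁).const_mul _).add ((hT w₂).const_mul _)
  rw [← integral_const_mul, ← integral_const_mul,
    ← integral_add ((hT w₁).const_mul _) ((hT w₂).const_mul _), ← sub_eq_iff_eq_add,
    ← integral_sub hC hsum]
  congr 1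
  ext x
  rw [dotC_curl_cutoffWave hχ, h₁, h₂, dotC_cutoffWave, dotC_cutoffWave]
  ring

theorem IsWeakSource.dotC_apex_eq_zero_aux {x₀ a b : R3} {θ r₀ r : ℝ} (ha : ‖a‖ = 1)
    (hb : ‖b‖ = 1) (hab : inner ℝ a b = 0) (hθ : 0 < θ) (hθ' : θ < Real.pi / 2) (hr₀ : 0 < r₀)
    (hr : 0 < r) {u v f g : R3 → C3} (hu : IntegrableOn u (truncatedCone x₀ a θ r₀))
    (hv : IntegrableOn v (truncatedCone x₀ a θ r₀))
    (hf : ContinuousOn f (closure (truncatedCone x₀ a θ r₀)))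
    (hg : ContinuousOn g (closure (truncatedCone x₀ a θ r₀))) {A B : ℂ} {κ : ℝ} (hκ : 0 ≤ κ)
    (hAB : A * B = κ) (h : IsWeakSource (truncatedCone x₀ a θ r₀) x₀ r A B u v f g) :
    dotC (g x₀) (toC3 b) + Complex.I * dotC (g x₀) (toC3 a) = 0 := by
  set K := truncatedCone x₀ a θ r₀
  have hKm : MeasurableSet K := (isOpen_truncatedCone ha hθ hθ').measurableSet
  have hKc : K ⊆ cone x₀ a θ := Set.inter_subset_left
  let χ : ContDiffBump x₀ := ⟨r / 4, r / 2, by positivity, by linarith⟩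
  have hχ : ContDiff ℝ ((⊤ : ℕ∞) : WithTop ℕ∞) χ := χ.contDiff
  have hχ' : HasCompactSupport χ := χ.hasCompactSupport
  have hχ₀ : χ x₀ = 1 := χ.one_of_mem_closedBall (Metric.mem_closedBall_self (by positivity))
  have hχs : tsupport χ ⊆ Metric.ball x₀ r := by
    rw [χ.tsupport_eq]
    exact Metric.closedBall_subset_ball (by simp only [χ]; linarith)
  let d : R3 := WithLp.toLp 2 fun i =>
    (![a 1 * b 2 - a 2 * b 1, a 2 * b 0 - a 0 * b 2, a 0 * b 1 - a 1 * b 0] : Fin 3 → ℝ) i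
  have hd : toC3 d = crossC (toC3 a) (toC3 b) := by
    ext j
    fin_cases j <;> simp [toC3, crossC, d]
  obtain ⟨had, hbd, hba⟩ := toC3_frame ha hb hab hd
  have hself : ∀ z : C3, crossC z z = 0 := fun z => by
    ext j
    fin_cases j <;> simp [crossC] <;> ring
  let s : ℝ → ℝ := fun τ => √(τ ^ 2 + κ)
  have hs : Tendsto (fun τ => s τ / τ) atTop (𝓝 1) := tendsto_sqrt_sq_add_div
  let Φ : C3 → ℝ → R3 → C3 := fun w τ => cutoffWave χ x₀ a b τ (s τ) w
  let T : (R3 → C3) → C3 → ℝ → ℂ := fun F w τ => ∫ x in K, dotC (F x) (Φ w τ x)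
  let R : (R3 → C3) → C3 → ℝ → ℂ := fun F w τ => ∫ x in K, planeWave x₀ a b τ (s τ) x *
    dotC (F x) (crossC (gradC (fun y => (χ y : ℂ)) x) w)
  have hΦ : ∀ w τ, IsTestField (Φ w τ) := fun w τ => isTestField_cutoffWave hχ hχ' _ _ _ _ _ _
  have hΦs : ∀ w τ, tsupport (Φ w τ) ⊆ Metric.ball x₀ r := fun w τ =>
    (tsupport_cutoffWave_subset _ _ _ _ _ _ _).trans hχs
  have hT0 : ∀ F τ, T F 0 τ = 0 := fun F τ => by
    simp [T, Φ, dotC_cutoffWave, dotC_zero_right]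
  have hTneg : ∀ F w τ, T F (-w) τ = -T F w τ := fun F w τ => by
    simp only [T, Φ, dotC_cutoffWave, dotC_neg_right, mul_neg]
    exact integral_neg _
  have hid : ∀ τ : ℝ, (τ : ℂ) * T g (toC3 b) τ + Complex.I * s τ * T g (toC3 a) τ =
      (τ : ℂ) * R v (toC3 b) τ + Complex.I * s τ * R v (toC3 a) τ +
        B * (T f (toC3 d) τ - R u (toC3 d) τ) := by
    intro τ
    have hs2 : ((s τ : ℝ) : ℂ) ^ 2 = (τ : ℂ) ^ 2 + A * B := by
      rw [hAB]
      exact_mod_cast Real.sq_sqrt (by positivity : 0 ≤ τ ^ 2 + κ)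
    have e1 := h.fst (Φ (toC3 d) τ) (hΦ _ _) (hΦs _ _)
    have e2 := h.snd (Φ (toC3 b) τ) (hΦ _ _) (hΦs _ _)
    have e3 := h.snd (Φ (toC3 a) τ) (hΦ _ _) (hΦs _ _)
    rw [integral_dotC_curl_cutoffWave hχ hχ' x₀ a b τ (s τ) hu _ _ _ had hbd] at e1
    rw [integral_dotC_curl_cutoffWave hχ hχ' x₀ a b τ (s τ) hv _ _ _ hd.symm (hself _)] at e2
    rw [integral_dotC_curl_cutoffWave hχ hχ' x₀ a b τ (s τ) hv _ _ _ (hself _) hba] at e3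
    change T f (toC3 d) τ = R u (toC3 d) τ + (-(τ : ℂ) * T u (-toC3 b) τ +
      Complex.I * s τ * T u (toC3 a) τ) + A * T v (toC3 d) τ at e1
    change T g (toC3 b) τ = R v (toC3 b) τ + (-(τ : ℂ) * T v (toC3 d) τ +
      Complex.I * s τ * T v 0 τ) + B * T u (toC3 b) τ at e2
    change T g (toC3 a) τ = R v (toC3 a) τ + (-(τ : ℂ) * T v 0 τ +
      Complex.I * s τ * T v (-toC3 d) τ) + B * T u (toC3 a) τ at e3
    rw [hTneg] at e1 e3
    rw [hT0] at e2 e3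
    linear_combination (τ : ℂ) * e2 + Complex.I * s τ * e3 - B * e1 + T v (toC3 d) τ * hs2
      - (s τ : ℂ) ^ 2 * T v (toC3 d) τ * Complex.I_sq
  have hTlim : ∀ {F : R3 → C3}, ContinuousOn F (closure K) → ∀ w,
      Tendsto (fun τ : ℝ => (τ : ℂ) ^ 3 * T F w τ) atTop _ := fun hF w =>
    tendsto_integral_dotC_cutoffWave (b := b) ha hθ hθ' hr₀ hF χ.continuous hχ₀ w hs
  have hRlim : ∀ {F : R3 → C3}, IntegrableOn F K → ∀ w n,
      Tendsto (fun τ : ℝ => (τ : ℂ) ^ n * R F w τ) atTop (𝓝 0) := by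
    intro F hF w n
    have hc : ContDiff ℝ 1 fun y => (χ y : ℂ) :=
      Complex.ofRealCLM.contDiff.comp (hχ.of_le (by exact_mod_cast le_top))
    refine tendsto_integral_mul_planeWave_of_far ha hθ hθ' hKc hKm
      (IntegrableOn.dotC hF (continuous_crossC_const (continuous_gradC hc) w) ?_) (δ := r / 4)
      (by positivity) (fun x hx => ?_) s n
    · have h1 : HasCompactSupport fun y => (χ y : ℂ) := hχ'.comp_left Complex.ofReal_zero
      exact (hasCompactSupport_gradC h1).comp_left (g := fun z => crossC z w) (crossC_zero_left w)
    · by_contra! hlt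
      exact hx (by rw [gradC_contDiffBump_eq_zero χ hlt, crossC_zero_left, dotC_zero_right])
  have hsC : Tendsto (fun τ => ((s τ / τ : ℝ) : ℂ)) atTop (𝓝 1) := by
    rw [← Complex.ofReal_one]
    exact (Complex.continuous_ofReal.tendsto _).comp hs
  have hinv : Tendsto (fun τ : ℝ => ((τ⁻¹ : ℝ) : ℂ)) atTop (𝓝 0) := by
    rw [← Complex.ofReal_zero]
    exact (Complex.continuous_ofReal.tendsto _).comp (tendsto_inv_atTop_zero (𝕜 := ℝ))
  have hL := (hTlim hg (toC3 b)).add ((hsC.const_mul Complex.I).mul (hTlim hg (toC3 a)))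
  have hR := ((hRlim hv (toC3 b) 3).add ((hsC.const_mul Complex.I).mul
    (hRlim hv (toC3 a) 3))).add (((hinv.mul (hTlim hf (toC3 d))).sub
      (hRlim hu (toC3 d) 2)).const_mul B)
  have hLR := tendsto_nhds_unique (hL.congr' ?_) hR
  · have hI := integral_cone_exp_ne_zero ha hb hab hθ hθ'
    simp only [mul_zero, zero_mul, add_zero, sub_zero, mul_one] at hLR
    refine (mul_eq_zero.1 (Eq.trans ?_ hLR)).resolve_right hI
    ring
  · filter_upwards [eventually_gt_atTop 0] with τ hτ
    have hτ' : (τ : ℂ) ≠ 0 := by exact_mod_cast hτ.ne'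
    push_cast
    field_simp
    linear_combination hid τ

theorem IsWeakSource.apex_eq_zero {x₀ a : R3} {θ r₀ r : ℝ} (ha : ‖a‖ = 1)
    (hθ : 0 < θ) (hθ' : θ < Real.pi / 2) (hr₀ : 0 < r₀)
    (hr : 0 < r) {u v f g : R3 → C3} (hu : IntegrableOn u (truncatedCone x₀ a θ r₀))
    (hv : IntegrableOn v (truncatedCone x₀ a θ r₀))
    (hf : ContinuousOn f (closure (truncatedCone x₀ a θ r₀)))
    (hg : ContinuousOn g (closure (truncatedCone x₀ a θ r₀))) {A B : ℂ} {κ : ℝ} (hκ : 0 ≤ κ)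
    (hAB : A * B = κ) (h : IsWeakSource (truncatedCone x₀ a θ r₀) x₀ r A B u v f g) :
    g x₀ = 0 := by
  have key : ∀ b : R3, ‖b‖ = 1 → inner ℝ a b = 0 →
      dotC (g x₀) (toC3 b) = 0 ∧ dotC (g x₀) (toC3 a) = 0 := by
    intro b hb hab
    have h1 := h.dotC_apex_eq_zero_aux ha hb hab hθ hθ' hr₀ hr hu hv hf hg hκ hAB
    have h2 := h.dotC_apex_eq_zero_aux ha (b := -b) (by rwa [norm_neg])
      (by rw [inner_neg_right, hab, neg_zero]) hθ hθ' hr₀ hr hu hv hf hg hκ hAB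
    rw [toC3_neg, dotC_neg_right] at h2
    refine ⟨by linear_combination (h1 - h2) / 2, ?_⟩
    refine (mul_eq_zero.1 (?_ : Complex.I * _ = 0)).resolve_left Complex.I_ne_zero
    linear_combination (h1 + h2) / 2
  obtain ⟨Bs, hBs⟩ := Orthonormal.exists_orthonormalBasis_extension_of_card_eq (𝕜 := ℝ) (E := R3)
    (ι := Fin 3) (by simp) (v := fun _ => a) (s := {0}) (by
      rw [orthonormal_iff_ite]
      rintro ⟨i, rfl⟩ ⟨j, rfl⟩
      simp [Set.domRestrict, ha])
  have hB0 : Bs 0 = a := hBs 0 rfl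
  have hall : ∀ i, dotC (g x₀) (toC3 (Bs i)) = 0 := by
    have ho : ∀ i, i ≠ 0 → dotC (g x₀) (toC3 (Bs i)) = 0 ∧ dotC (g x₀) (toC3 a) = 0 := fun i hi =>
      key (Bs i) (Bs.orthonormal.1 i) (by rw [← hB0]; exact Bs.orthonormal.2 hi.symm)
    intro i
    by_cases hi : i = 0
    · rw [hi, hB0]
      exact (ho 1 (by simp)).2
    · exact (ho i hi).1
  let L : R3 →ₗ[ℝ] ℂ :=
    { toFun := fun v => dotC (g x₀) (toC3 v)
      map_add' := fun v w => by simp [dotC, toC3, mul_add, Finset.sum_add_distrib]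
      map_smul' := fun c v => by simp [dotC, toC3, Finset.mul_sum, mul_left_comm] }
  have hL : L = 0 := Bs.toBasis.ext fun i => by
    rw [Bs.coe_toBasis]
    exact hall i
  ext i
  have := LinearMap.congr_fun hL (EuclideanSpace.single i 1)
  simpa [L, dotC, toC3, PiLp.single_apply, apply_ite Complex.ofReal] using this

theorem integrableOn_smul_of_memLp {Ω : Set R3} [IsFiniteMeasure (volume.restrict Ω)]
    {m : R3 → ℂ} (hm : MemLp m ⊤ (volume.restrict Ω)) {u : R3 → C3}
    (hu : MemLp u 2 (volume.restrict Ω)) : IntegrableOn (fun x => m x • u x) Ω :=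
  (hu.smul (r := 2) hm).integrable (by norm_num)

theorem HasEssValueAt.eq_zero_of_smul {K : Set R3} (hK : MeasurableSet K) {x₀ : R3} {c : R3 → ℂ}
    {c₀ : ℂ} (hc : HasEssValueAt K c x₀ c₀) (hc₀ : c₀ ≠ 0) {F u : R3 → C3}
    (hF : Tendsto F (𝓝[K] x₀) (𝓝 0)) (hFu : F =ᵐ[volume.restrict K] fun x => c x • u x) :
    HasEssValueAt K u x₀ 0 := by
  have hle : ae (volume.restrict K) ⊓ 𝓝 x₀ ≤ 𝓝[K] x₀ := by
    rw [nhdsWithin, inf_comm]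
    exact inf_le_inf_left _ (le_principal_iff.2 (ae_restrict_mem hK))
  have h1 := (hc.inv₀ hc₀).smul (hF.mono_left hle)
  rw [smul_zero] at h1
  refine h1.congr' ?_
  filter_upwards [hc.eventually_ne hc₀, hFu.filter_mono inf_le_left] with x hx hx'
  rw [hx', smul_smul, inv_mul_cancel₀ hx, one_smul]

theorem IsHolderRepresentative.continuousOn {K : Set R3} {α : ℝ≥0} (hα : 0 < α) {f F : R3 → C3}
    (h : IsHolderRepresentative K α f F) : ContinuousOn F (closure K) :=
  let ⟨_, hC⟩ := h.1
  hC.continuousOn hα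

theorem TangentialTraceEqOn.integral_corner {Ω Γ : Set R3} (hΩ : IsOpen Ω)
    [IsFiniteMeasure (volume.restrict Ω)] {u v : R3 → C3} {m : R3 → ℂ} {m₀ c : ℂ} {p q F : R3 → C3}
    (hp : MemLp p 2 (volume.restrict Ω)) (hq : MemLp q 2 (volume.restrict Ω))
    (hm : MemLp m ⊤ (volume.restrict Ω)) (hu : IsWeakCurl Ω u fun x => (c * m x) • p x)
    (hv : IsWeakCurl Ω v fun x => (c * m₀) • q x) (htr : TangentialTraceEqOn Ω Γ u v)
    {K U : Set R3} {x₀ : R3} {r r₀ : ℝ} (hr : r ≤ r₀) (hK : Ω ∩ Metric.ball x₀ r₀ = K)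
    (hΓ : Γ = frontier Ω ∩ U) (hU : Metric.ball x₀ r ⊆ U) (hFc : ContinuousOn F (closure K))
    (hKc : IsCompact (closure K)) (hF : F =ᵐ[volume.restrict K] fun x => (m x - m₀) • p x)
    {φ : R3 → C3} (hφ : IsTestField φ) (hφr : tsupport φ ⊆ Metric.ball x₀ r) :
    ∫ x in K, dotC (c • F x) (φ x) = (∫ x in K, dotC (u x - v x) (curl φ x)) +
      -(c * m₀) * ∫ x in K, dotC (p x - q x) (φ x) := by
  have hKΩ : K ⊆ Ω := hK ▸ Set.inter_subset_left
  have hpi : IntegrableOn (fun x => (c * m x) • p x) Ω := by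
    refine ((integrableOn_smul_of_memLp hm hp).smul c).congr (ae_of_all _ fun x => ?_)
    simp [smul_smul]
  have hqi : IntegrableOn q Ω := hq.integrable (by norm_num)
  have h := htr.integral_eq hΩ hpi (hqi.smul (c * m₀)) hu hv hφ (fun x hx => by
    rw [hΓ]
    exact ⟨hx.2, hU (hφr hx.1)⟩)
  have hdiff : ∀ x ∈ Ω \ K, x ∉ tsupport φ := fun x hx hxs =>
    hx.2 (hK ▸ ⟨hx.1, Metric.ball_subset_ball hr (hφr hxs)⟩)
  have hcurl : tsupport (curl φ) ⊆ tsupport φ := by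
    refine closure_minimal (fun x hx => ?_) (isClosed_tsupport φ)
    by_contra hxs
    refine hx ?_
    have h0 : fderiv ℝ φ x = 0 :=
      image_eq_zero_of_notMem_tsupport fun h => hxs (tsupport_fderiv_subset ℝ h)
    ext j
    fin_cases j <;> simp [curl, partialDeriv, h0]
  rw [setIntegral_eq_of_subset_of_forall_sdiff_eq_zero hΩ.measurableSet hKΩ (fun x hx => by
      rw [image_eq_zero_of_notMem_tsupport (hdiff x hx), dotC_zero_right]),
    setIntegral_eq_of_subset_of_forall_sdiff_eq_zero hΩ.measurableSet hKΩ (fun x hx => by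
      rw [image_eq_zero_of_notMem_tsupport (fun h => hdiff x hx (hcurl h)), dotC_zero_right])] at h
  have hFi : IntegrableOn F K := (hFc.integrableOn_compact hKc).mono_set subset_closure
  have hpq : IntegrableOn (fun x => p x - q x) K :=
    ((hp.integrable (by norm_num)).sub hqi).mono_measure (Measure.restrict_mono hKΩ le_rfl)
  have h1 : ∫ x in K, dotC ((c * m x) • p x - (c * m₀) • q x) (φ x) =
      ∫ x in K, (dotC (c • F x) (φ x) + (c * m₀) * dotC (p x - q x) (φ x)) := by
    refine integral_congr_ae (hF.mono fun x hx => ?_)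
    simp only [hx, dotC_sub_left, dotC_smul_left]
    ring
  have hFi' : IntegrableOn (fun x => c • F x) K := hFi.smul c
  simp only [Pi.smul_apply] at h
  rw [h1, integral_add (IntegrableOn.dotC hFi' hφ.continuous hφ.2)
    ((IntegrableOn.dotC hpq hφ.continuous hφ.2).const_mul _), integral_const_mul] at h
  linear_combination h

theorem theorem4p1
    (Ω Γ : Set R3) (hΩ : IsBoundedLipschitzDomain Ω) (hΓ : IsRelOpenBoundaryPart Ω Γ)
    (ω ε₀ μ₀ : ℝ) (hω : 0 < ω) (hε₀ : 0 < ε₀) (hμ₀ : 0 < μ₀)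
    (ε μ σ : R3 → ℝ) (hmed : IsMedium Ω ε μ σ)
    (Et Ht E0 H0 : R3 → C3)
    (heig : IsTransmissionEigenfunctions Ω Γ ω ε₀ μ₀ ε μ σ Et Ht E0 H0)
    -- the conical corner of `Ω` with apex `x₀ ∈ Γ`
    (x₀ a : R3) (θ₀ r₀ : ℝ) (hx₀ : x₀ ∈ Γ) (ha : ‖a‖ = 1)
    (hθ₀ : 0 < θ₀) (hθ₀' : θ₀ < Real.pi / 2) (hr₀ : 0 < r₀)
    (hcorner : Ω ∩ Metric.ball x₀ r₀ = truncatedCone x₀ a θ₀ r₀)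
    -- Hölder regularity of `(μ - μ₀) H^t` and `(γ - ε₀) E^t` up to the boundary of the corner
    (α : ℝ≥0) (hα : 0 < α) (hα' : α < 1) (F G : R3 → C3)
    (hF : IsHolderRepresentative (truncatedCone x₀ a θ₀ r₀) α
      (fun x => ((μ x : ℂ) - (μ₀ : ℂ)) • Ht x) F)
    (hG : IsHolderRepresentative (truncatedCone x₀ a θ₀ r₀) α
      (fun x => (gammaCoeff ω ε σ x - (ε₀ : ℂ)) • Et x) G) :
    F x₀ = 0 ∧ G x₀ = 0 ∧
    (∀ m : ℝ, HasEssValueAt (truncatedCone x₀ a θ₀ r₀) μ x₀ m → m ≠ μ₀ →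
      HasEssValueAt (truncatedCone x₀ a θ₀ r₀) Ht x₀ 0) ∧
    (∀ g : ℂ, HasEssValueAt (truncatedCone x₀ a θ₀ r₀) (gammaCoeff ω ε σ) x₀ g →
      g ≠ (ε₀ : ℂ) → HasEssValueAt (truncatedCone x₀ a θ₀ r₀) Et x₀ 0) := by
  have hΩo := hΩ.isOpen
  have : IsFiniteMeasure (volume.restrict Ω) :=
    isFiniteMeasure_restrict.2 hΩ.isBounded.measure_lt_top.ne
  have hKΩ : truncatedCone x₀ a θ₀ r₀ ⊆ Ω := hcorner ▸ Set.inter_subset_left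
  have hKm := (isOpen_truncatedCone (x₀ := x₀) (r := r₀) ha hθ₀ hθ₀').measurableSet
  have hKc := isCompact_closure_truncatedCone x₀ a θ₀ r₀
  have hFc := hF.continuousOn hα
  have hGc := hG.continuousOn hα
  obtain ⟨U, hU, hΓU⟩ := hΓ
  obtain ⟨ρ, hρ, hρU⟩ := Metric.isOpen_iff.1 hU x₀ (hΓU ▸ hx₀ : x₀ ∈ frontier Ω ∩ U).2
  obtain ⟨_, hEt⟩ := heig.memHCurl_Et
  obtain ⟨_, hHt⟩ := heig.memHCurl_Ht
  obtain ⟨_, hE0⟩ := heig.memHCurl_E0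
  obtain ⟨_, hH0⟩ := heig.memHCurl_H0
  have hμ : MemLp (fun x => (μ x : ℂ)) ⊤ (volume.restrict Ω) := hmed.memLp_mu.ofReal
  have hγ : MemLp (gammaCoeff ω ε σ) ⊤ (volume.restrict Ω) := by
    have h1 : MemLp (fun x => (ε x : ℂ)) ⊤ (volume.restrict Ω) := hmed.memLp_eps.ofReal
    have h2 : MemLp (fun x => (σ x : ℂ)) ⊤ (volume.restrict Ω) := hmed.memLp_sigma.ofReal
    refine (h1.add (h2.const_mul (Complex.I / ω))).ae_eq (ae_of_all _ fun x => ?_)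
    simp only [gammaCoeff, Pi.add_apply]
    ring
  have hint : ∀ {u v : R3 → C3}, MemLp u 2 (volume.restrict Ω) → MemLp v 2 (volume.restrict Ω) →
      IntegrableOn (fun x => u x - v x) (truncatedCone x₀ a θ₀ r₀) := fun hu hv =>
    ((hu.sub hv).integrable (by norm_num)).mono_measure (Measure.restrict_mono hKΩ le_rfl)
  have hsrc : IsWeakSource (truncatedCone x₀ a θ₀ r₀) x₀ (min ρ r₀)
      (-(Complex.I * ω * μ₀)) (-(-(Complex.I * ω) * ε₀))
      (fun x => Et x - E0 x) (fun x => Ht x - H0 x)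
      (fun x => (Complex.I * ω) • F x) (fun x => (-(Complex.I * ω)) • G x) := by
    have hball : Metric.ball x₀ (min ρ r₀) ⊆ U :=
      (Metric.ball_subset_ball (min_le_left _ _)).trans hρU
    refine ⟨fun φ hφ hφs => ?_, fun φ hφ hφs => ?_⟩
    · exact heig.trace_E.integral_corner hΩo hHt.memLp hH0.memLp hμ heig.curl_Et heig.curl_E0
        (min_le_right _ _) hcorner hΓU hball hFc hKc hF.2 hφ hφs
    · refine heig.trace_H.integral_corner hΩo hEt.memLp hE0.memLp hγ ?_ ?_
        (min_le_right _ _) hcorner hΓU hball hGc hKc hG.2 hφ hφs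
      · simpa only [neg_mul] using heig.curl_Ht
      · simpa only [neg_mul] using heig.curl_H0
  have hAB : -(Complex.I * ω * μ₀) * -(-(Complex.I * ω) * ε₀) = ((ω ^ 2 * μ₀ * ε₀ : ℝ) : ℂ) := by
    push_cast
    linear_combination (-(ω : ℂ) ^ 2 * μ₀ * ε₀) * Complex.I_sq
  have hIω : Complex.I * (ω : ℂ) ≠ 0 :=
    mul_ne_zero Complex.I_ne_zero (by exact_mod_cast hω.ne')
  have hr : 0 < min ρ r₀ := lt_min hρ hr₀
  have hκ : 0 ≤ ω ^ 2 * μ₀ * ε₀ := by positivity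
  have hu := hint hEt.memLp hE0.memLp
  have hv := hint hHt.memLp hH0.memLp
  have hF' : ContinuousOn (fun x => (Complex.I * ω) • F x)
    (closure (truncatedCone x₀ a θ₀ r₀)) := hFc.const_smul (Complex.I * ω : ℂ)
  have hG' : ContinuousOn (fun x => (-(Complex.I * ω)) • G x)
    (closure (truncatedCone x₀ a θ₀ r₀)) := hGc.const_smul (-(Complex.I * ω) : ℂ)
  have hG0 : G x₀ = 0 := (smul_eq_zero.1 (hsrc.apex_eq_zero ha hθ₀ hθ₀' hr₀ hr hu hv hF' hG' hκ
    hAB)).resolve_left (neg_ne_zero.2 hIω)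
  have hF0 : F x₀ = 0 := (smul_eq_zero.1 (hsrc.symm.apex_eq_zero ha hθ₀ hθ₀' hr₀ hr hv hu hG' hF'
    hκ ((mul_comm _ _).trans hAB))).resolve_left hIω
  have hmem := mem_closure_truncatedCone (x₀ := x₀) ha hθ₀ hr₀
  have hlim : ∀ {P : R3 → C3}, ContinuousOn P (closure (truncatedCone x₀ a θ₀ r₀)) → P x₀ = 0 →
      Tendsto P (𝓝[truncatedCone x₀ a θ₀ r₀] x₀) (𝓝 0) := fun hP hP0 =>
    hP0 ▸ (hP x₀ hmem).mono_left (nhdsWithin_mono _ subset_closure)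
  refine ⟨hF0, hG0, fun m hm hne => ?_, fun g hg hne => ?_⟩
  · have h1 : HasEssValueAt (truncatedCone x₀ a θ₀ r₀) (fun x => (μ x : ℂ) - (μ₀ : ℂ)) x₀
        ((m : ℂ) - μ₀) := ((Complex.continuous_ofReal.tendsto _).comp hm).sub_const _
    exact h1.eq_zero_of_smul hKm (sub_ne_zero.2 (by exact_mod_cast hne)) (hlim hFc hF0) hF.2
  · have h1 : HasEssValueAt (truncatedCone x₀ a θ₀ r₀) (fun x => gammaCoeff ω ε σ x - (ε₀ : ℂ)) x₀
        (g - ε₀) := Tendsto.sub_const hg _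
    exact h1.eq_zero_of_smul hKm (sub_ne_zero.2 hne) (hlim hGc hG0) hG.2
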